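/- Let $G$ be an ordered (i.e. totally ordered) abelian group and $k$ a field (respectively, an ordered field). Let $v_G$ be the natural valuation of $G$, given by $v_G(g)\le v_G(h)\Leftrightarrow \exists n\in\mathbb N,\ |h|\le n|g|$, with $v_G(0)=\infty$ the maximum, and let $\Gamma:=v_G(G\setminus\{0\})$ be the value chain of $G$. Let $K:=k((G))$ be the field of generalized power series with well-ordered support, with its usual valuation $v(a)=\min\operatorname{supp}(a)$ (and, if $k$ is ordered, with the order in which $a<b$ if and only if $a_g<b_g$ for $g=v(a-b)$). For a field $L$ with a valuation $w$ and a derivation $D$, let $C=\ker D$, let $\mathcal O_w$ be the valuation ring and $\mathfrak m_w$ its maximal ideal. $(L,w,D)$ is *pre-differential-valued* if $w(D(a))>w(D(b)/b)$ for all $a\in\mathcal O_w$ and $0\ne b\in\mathfrak m_w$, and *differential-valued* if moreover $\mathcal O_w=\mathfrak m_w+C$. Its asymptotic couple is $(G_w,\psi)$, where $G_w$ is the value group and $\psi(w(a)):=w(D(a)/a)$ for $a\neq0$, $w(a)\ne0$; it is an asymptotic couple, i.e. for all nonzero $g,h\in G_w$ one has $\psi(g+h)\ge\min(\psi(g),\psi(h))$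 if $g+h\neq 0$, $\psi(ng)=\psi(g)$ for all integers $n\ne0$, and $\psi(g)<\psi(h)+|h|$. It is *of H-type* if $g\le h<0$ implies $\psi(g)\le\psi(h)$. A derivation $D$ on $K$ is an *H-derivation* if $(K,v,D)$ is a differential-valued field whose asymptotic couple is of H-type. An ordered field $L$ with a derivation $D$ is an *H-field* if, for the valuation $w$ with valuation ring $\mathcal O_w=\{a : \exists c\in C,\ |a|\le c\}$, the triple $(L,w,D)$ is pre-differential-valued, $\mathcal O_w$ is convex, $D(a)>0$ for all $a>\mathcal O_w$, and $\mathcal O_w=\mathfrak m_w+C$. Then there exists an H-derivation $D$ on $K$, making $(K,v,D)$ a differential-valued field (respectively, an H-derivation $D$ on $K$ such that moreover $(K,\le,D)$ is an H-field), if and only if there exists an increasing (i.e. order-preserving, not necessarily strictly) map $\sigma:\Gamma\to G^{\le0}$ such that: 1. $v_G\circ\sigma:\Gamma\to\Gamma\cup\{\infty\}$ is a right-shift, i.e. $v_G(\sigma(\gamma))>\gamma$ for all $\gamma\in\Gamma$; 2. for every $f\in\sigma(\Gamma)$, the group $$B_\sigma(f):=\bigl(\{g\ne0 : \sigma(v_G(g))\ge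 f\}\cup\{0\}\bigr)\big/\bigl(\{g\neq0 : \sigma(v_G(g))>f\}\cup\{0\}\bigr)$$ is embeddable as a group into $(k,+)$ (respectively, is embeddable as an ordered group into $(k,+,\le)$, where $B_\sigma(f)$ carries the order induced from $G$ on the quotient by a convex subgroup). -/

import Mathlib

open scoped HahnSeries

namespace HDer

/-! ### Differential-valued fields and H-fields -/

section Field

variable {K : Type*} [Field K]

/-- The field of constants of a differential field. -/
def constants (D : Derivation ℤ K K) : Subfield K where
  carrier := {a | D a = 0}
  mul_mem' {a b} ha hb := by
    have ha' : D a = 0 := ha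
    have hb' : D b = 0 := hb
    simp [ha', hb']
  one_mem' := by simp
  add_mem' {a b} ha hb := by
    have ha' : D a = 0 := ha
    have hb' : D b = 0 := hb
    simp [ha', hb']
  zero_mem' := by simp
  neg_mem' {a} ha := by
    have ha' : D a = 0 := ha
    simp [ha']
  inv_mem' a ha := by
    have ha' : D a = 0 := ha
    simp [Derivation.leibniz_inv, ha']

variable {V : Type*} [LinearOrderedAddCommMonoidWithTop V]

/-- Pre-differential-valued field: if `a` lies in the valuation ring and `b ≠ 0` in the maximal
ideal, then `v (D a) > v (D b / b)`. -/
structure IsPreDifferentialValued (v : AddValuation K V) (D : Derivation ℤ K K) : Prop where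
  dv2 : ∀ a b : K, 0 ≤ v a → 0 < v b → b ≠ 0 → v (D b / b) < v (D a)

/-- The valuation ring is the sum of the maximal ideal and the field of constants
(equality of sets). -/
def RingEqIdealAddConstants (v : AddValuation K V) (D : Derivation ℤ K K) : Prop :=
  ∀ a : K, 0 ≤ v a ↔ ∃ m c : K, 0 < v m ∧ c ∈ constants D ∧ a = m + c

/-- Differential-valued field. -/
structure IsDifferentialValued (v : AddValuation K V) (D : Derivation ℤ K K) : Prop
    extends IsPreDifferentialValued v D where
  dv1 : RingEqIdealAddConstants v D

variable [LinearOrder K]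

/-- Pre-H-field. -/
structure IsPreHField (v : AddValuation K V) (D : Derivation ℤ K K) : Prop
    extends IsPreDifferentialValued v D where
  convex : Set.OrdConnected {a : K | 0 ≤ v a}
  pos : ∀ a : K, (∀ b : K, 0 ≤ v b → b < a) → 0 < D a

variable [IsStrictOrderedRing K]

/-- The valuation ring `{a | ∃ c ∈ C, |a| ≤ c}`, where `C` is the field of constants. -/
def constantHull (D : Derivation ℤ K K) : ValuationSubring K where
  carrier := {a | ∃ c ∈ constants D, |a| ≤ c}
  mul_mem' := by
    rintro a b ⟨c, hc, hac⟩ ⟨d, hd, hbd⟩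
    refine ⟨c * d, mul_mem hc hd, ?_⟩
    rw [abs_mul]
    exact mul_le_mul hac hbd (abs_nonneg b) ((abs_nonneg a).trans hac)
  one_mem' := ⟨1, one_mem _, by simp⟩
  add_mem' := by
    rintro a b ⟨c, hc, hac⟩ ⟨d, hd, hbd⟩
    exact ⟨c + d, add_mem hc hd, (abs_add_le a b).trans (add_le_add hac hbd)⟩
  zero_mem' := ⟨0, zero_mem _, by simp⟩
  neg_mem' := by
    rintro a ⟨c, hc, hac⟩
    exact ⟨c, hc, by rwa [abs_neg]⟩
  mem_or_inv_mem' := by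
    intro a
    rcases le_total |a| 1 with h | h
    · exact Or.inl ⟨1, one_mem _, h⟩
    · exact Or.inr ⟨1, one_mem _, by rw [abs_inv]; exact inv_le_one_of_one_le₀ h⟩

/-- The valuation, written additively, whose valuation ring is `constantHull D`. -/
noncomputable def hullValuation (D : Derivation ℤ K K) :
    AddValuation K (Additive (constantHull D).ValueGroup)ᵒᵈ :=
  Valuation.toAddValuation (constantHull D).valuation

/-- H-field. -/
structure IsHField (D : Derivation ℤ K K) : Prop where
  h1 : IsPreHField (hullValuation D) D
  h2 : RingEqIdealAddConstants (hullValuation D) D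

end Field

/-! ### Asymptotic couples and H-derivations -/

section Couple

variable {G : Type*} [AddCommGroup G] [LinearOrder G]

/-- Asymptotic couple `(G, ψ)`, with `ψ` defined on the nonzero elements of `G`. -/
structure IsAsymptoticCouple (ψ : {g : G // g ≠ 0} → G) : Prop where
  ac1 : ∀ (g h : {g : G // g ≠ 0}) (hgh : (g : G) + h ≠ 0),
    min (ψ g) (ψ h) ≤ ψ ⟨(g : G) + h, hgh⟩
  ac2 : ∀ (g : {g : G // g ≠ 0}) (n : ℤ) (hn : n • (g : G) ≠ 0), ψ ⟨n • (g : G), hn⟩ = ψ g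
  ac3 : ∀ g h : {g : G // g ≠ 0}, ψ g < ψ h + |(h : G)|

/-- Asymptotic couple of H-type. -/
structure IsHTypeAsymptoticCouple (ψ : {g : G // g ≠ 0} → G) : Prop
    extends IsAsymptoticCouple ψ where
  ach : ∀ g h : {g : G // g ≠ 0}, (g : G) ≤ h → (h : G) < 0 → ψ g ≤ ψ h

variable [IsOrderedAddMonoid G] {K : Type*} [Field K]

/-- `ψ` is the map induced on the value group by the logarithmic derivative:
`ψ (v a) = v (D a / a)` whenever `a ≠ 0` and `v a ≠ 0`. -/
def IsInducedByLogDeriv (v : AddValuation K (WithTop G)) (D : Derivation ℤ K K)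
    (ψ : {g : G // g ≠ 0} → G) : Prop :=
  ∀ (a : K) (g : {g : G // g ≠ 0}), v a = ((g : G) : WithTop G) →
    v (D a / a) = ((ψ g : G) : WithTop G)

/-- `D` is an H-derivation on `(K, v)`: `(K, v, D)` is a differential-valued field whose
asymptotic couple is of H-type. (`v` is meant to be onto `G ∪ {∞}`, so that `G` is the
value group.) -/
def IsHDerivation (v : AddValuation K (WithTop G)) (D : Derivation ℤ K K) : Prop :=
  IsDifferentialValued v D ∧
    ∃ ψ : {g : G // g ≠ 0} → G, IsInducedByLogDeriv v D ψ ∧ IsHTypeAsymptoticCouple ψ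

/-- The usual valuation `min supp` on `k((G))`, seen on the copy `Lex k⟦G⟧` of this field which
carries the lexicographic order. -/
noncomputable def lexVal (G k : Type*) [AddCommGroup G] [LinearOrder G] [IsOrderedAddMonoid G]
    [Field k] : AddValuation (Lex k⟦G⟧) (WithTop G) :=
  (HahnSeries.addVal G k).comap
    ({ toFun := ofLex
       map_one' := rfl
       map_mul' := fun _ _ => rfl
       map_zero' := rfl
       map_add' := fun _ _ => rfl } : Lex k⟦G⟧ →+* k⟦G⟧)

end Couple

/-! ### Shifts. The value chain `Γ` of `G` is `FiniteArchimedeanClass G`, the natural valuation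
`v_G : G → Γ ∪ {∞}` is `ArchimedeanClass.mk`. -/

section Shift

variable {G : Type*} [AddCommGroup G] [LinearOrder G] [IsOrderedAddMonoid G]

/-- `v_G ∘ σ : Γ → Γ ∪ {∞}` is a right-shift. -/
def IsRightShift (σ : FiniteArchimedeanClass G → Set.Iic (0 : G)) : Prop :=
  ∀ γ : FiniteArchimedeanClass G,
    (γ : ArchimedeanClass G) < ArchimedeanClass.mk ((σ γ : Set.Iic (0 : G)) : G)

/-- The subgroup `{g | σ (v_G g) ≥ f} ∪ {0}`. -/
noncomputable def groupPlus (σ : FiniteArchimedeanClass G →o Set.Iic (0 : G))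
    (f : Set.Iic (0 : G)) : AddSubgroup G where
  carrier := {g | ∀ hg : g ≠ 0, f ≤ σ (FiniteArchimedeanClass.mk g hg)}
  zero_mem' := fun h => absurd rfl h
  neg_mem' := by
    intro g hg h
    have h' : g ≠ 0 := neg_ne_zero.mp h
    have e : FiniteArchimedeanClass.mk (-g) h = FiniteArchimedeanClass.mk g h' :=
      Subtype.ext (ArchimedeanClass.mk_neg g)
    rw [e]
    exact hg h'
  add_mem' := by
    intro a b ha hb h
    by_cases ha0 : a = 0
    · subst ha0
      have hb0 : b ≠ 0 := by simpa using h
      have e : FiniteArchimedeanClass.mk (0 + b) h = FiniteArchimedeanClass.mk b hb0 := by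
        simp
      rw [e]
      exact hb hb0
    by_cases hb0 : b = 0
    · subst hb0
      have e : FiniteArchimedeanClass.mk (a + 0) h = FiniteArchimedeanClass.mk a ha0 := by
        simp
      rw [e]
      exact ha ha0
    have key := ArchimedeanClass.min_le_mk_add a b
    rcases min_le_iff.mp key with h1 | h1
    · exact (ha ha0).trans (σ.monotone h1)
    · exact (hb hb0).trans (σ.monotone h1)

/-- The subgroup `{g | σ (v_G g) > f} ∪ {0}`. -/
noncomputable def groupMinus (σ : FiniteArchimedeanClass G →o Set.Iic (0 : G))
    (f : Set.Iic (0 : G)) : AddSubgroup G where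
  carrier := {g | ∀ hg : g ≠ 0, f < σ (FiniteArchimedeanClass.mk g hg)}
  zero_mem' := fun h => absurd rfl h
  neg_mem' := by
    intro g hg h
    have h' : g ≠ 0 := neg_ne_zero.mp h
    have e : FiniteArchimedeanClass.mk (-g) h = FiniteArchimedeanClass.mk g h' :=
      Subtype.ext (ArchimedeanClass.mk_neg g)
    rw [e]
    exact hg h'
  add_mem' := by
    intro a b ha hb h
    by_cases ha0 : a = 0
    · subst ha0
      have hb0 : b ≠ 0 := by simpa using h
      have e : FiniteArchimedeanClass.mk (0 + b) h = FiniteArchimedeanClass.mk b hb0 := by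
        simp
      rw [e]
      exact hb hb0
    by_cases hb0 : b = 0
    · subst hb0
      have e : FiniteArchimedeanClass.mk (a + 0) h = FiniteArchimedeanClass.mk a ha0 := by
        simp
      rw [e]
      exact ha ha0
    have key := ArchimedeanClass.min_le_mk_add a b
    rcases min_le_iff.mp key with h1 | h1
    · exact (ha ha0).trans_le (σ.monotone h1)
    · exact (hb hb0).trans_le (σ.monotone h1)

/-- `groupMinus` is convex. -/
theorem mem_groupMinus_of_le (σ : FiniteArchimedeanClass G →o Set.Iic (0 : G))
    (f : Set.Iic (0 : G)) {a b : G} (hb : b ∈ groupMinus σ f) (h0 : 0 ≤ a) (hab : a ≤ b) :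
    a ∈ groupMinus σ f := by
  intro ha
  have hb0 : b ≠ 0 := fun h => ha (le_antisymm (h ▸ hab) h0)
  exact (hb hb0).trans_le
    (σ.monotone (ArchimedeanClass.mk_antitoneOn h0 (h0.trans hab : (0 : G) ≤ b) hab))

/-- The quotient group `B_σ(f) = G_σ(f,+) / G_σ(f,-)`. -/
def Component (σ : FiniteArchimedeanClass G →o Set.Iic (0 : G)) (f : Set.Iic (0 : G)) :=
  groupPlus σ f ⧸ (groupMinus σ f).addSubgroupOf (groupPlus σ f)

noncomputable instance (σ : FiniteArchimedeanClass G →o Set.Iic (0 : G)) (f : Set.Iic (0 : G)) :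
    AddCommGroup (Component σ f) :=
  inferInstanceAs
    (AddCommGroup (groupPlus σ f ⧸ (groupMinus σ f).addSubgroupOf (groupPlus σ f)))

/-- The canonical projection `G_σ(f,+) → B_σ(f)`. -/
noncomputable def Component.proj (σ : FiniteArchimedeanClass G →o Set.Iic (0 : G))
    (f : Set.Iic (0 : G)) : groupPlus σ f →+ Component σ f :=
  QuotientAddGroup.mk' ((groupMinus σ f).addSubgroupOf (groupPlus σ f))

theorem Component.proj_surjective (σ : FiniteArchimedeanClass G →o Set.Iic (0 : G))
    (f : Set.Iic (0 : G)) : Function.Surjective (Component.proj σ f) :=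
  QuotientAddGroup.mk'_surjective _

theorem Component.proj_eq_zero_iff (σ : FiniteArchimedeanClass G →o Set.Iic (0 : G))
    (f : Set.Iic (0 : G)) (g : groupPlus σ f) :
    Component.proj σ f g = 0 ↔ (g : G) ∈ groupMinus σ f :=
  (QuotientAddGroup.eq_zero_iff g).trans AddSubgroup.mem_addSubgroupOf

/-- The order induced on the quotient: `x ≤ y` iff `x`, `y` have representatives `g ≤ h`. -/
instance (σ : FiniteArchimedeanClass G →o Set.Iic (0 : G)) (f : Set.Iic (0 : G)) :
    LE (Component σ f) where
  le x y := ∃ g h : groupPlus σ f, Component.proj σ f g = x ∧ Component.proj σ f h = y ∧ g ≤ h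

theorem Component.proj_le_proj_iff (σ : FiniteArchimedeanClass G →o Set.Iic (0 : G))
    (f : Set.Iic (0 : G)) (g h : groupPlus σ f) :
    Component.proj σ f g ≤ Component.proj σ f h ↔ (g : G) - h ∈ groupMinus σ f ∨ g ≤ h := by
  constructor
  · rintro ⟨a, b, ha, hb, hab⟩
    by_contra! hne
    obtain ⟨h1, h2⟩ := hne
    apply h1
    have ha' : (g : G) - a ∈ groupMinus σ f := by
      have := (Component.proj_eq_zero_iff σ f (g - a)).mp (by rw [map_sub, ha, sub_self])
      simpa using this
    have hb' : (b : G) - h ∈ groupMinus σ f := by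
      have := (Component.proj_eq_zero_iff σ f (b - h)).mp (by rw [map_sub, hb, sub_self])
      simpa using this
    refine mem_groupMinus_of_le σ f (add_mem ha' hb') (sub_nonneg.mpr (le_of_lt h2)) ?_
    have hab' : (a : G) ≤ b := hab
    calc (g : G) - h ≤ ((g : G) - h) + ((b : G) - a) :=
          le_add_of_nonneg_right (sub_nonneg.mpr hab')
      _ = (g - a) + (b - h) := by abel
  · rintro (h1 | h1)
    · refine ⟨h, h, ?_, rfl, le_refl h⟩
      have := (Component.proj_eq_zero_iff σ f (g - h)).mpr (by simpa using h1)
      rw [map_sub, sub_eq_zero] at this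
      exact this.symm
    · exact ⟨g, h, rfl, rfl, h1⟩

noncomputable instance (σ : FiniteArchimedeanClass G →o Set.Iic (0 : G)) (f : Set.Iic (0 : G)) :
    LinearOrder (Component σ f) where
  le_refl x := by
    obtain ⟨g, rfl⟩ := Component.proj_surjective σ f x
    exact ⟨g, g, rfl, rfl, le_refl g⟩
  le_trans x y z hxy hyz := by
    obtain ⟨a, rfl⟩ := Component.proj_surjective σ f x
    obtain ⟨b, rfl⟩ := Component.proj_surjective σ f y
    obtain ⟨c, rfl⟩ := Component.proj_surjective σ f z
    rcases (Component.proj_le_proj_iff σ f a b).mp hxy with h1 | h1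
    · have e : Component.proj σ f a = Component.proj σ f b := by
        have := (Component.proj_eq_zero_iff σ f (a - b)).mpr (by simpa using h1)
        rwa [map_sub, sub_eq_zero] at this
      rw [e]
      exact hyz
    rcases (Component.proj_le_proj_iff σ f b c).mp hyz with h2 | h2
    · have e : Component.proj σ f b = Component.proj σ f c := by
        have := (Component.proj_eq_zero_iff σ f (b - c)).mpr (by simpa using h2)
        rwa [map_sub, sub_eq_zero] at this
      rw [← e]
      exact hxy
    · exact ⟨a, c, rfl, rfl, h1.trans h2⟩
  le_antisymm x y hxy hyx := by
    obtain ⟨a, rfl⟩ := Component.proj_surjective σ f x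
    obtain ⟨b, rfl⟩ := Component.proj_surjective σ f y
    rcases (Component.proj_le_proj_iff σ f a b).mp hxy with h1 | h1
    · have := (Component.proj_eq_zero_iff σ f (a - b)).mpr (by simpa using h1)
      rwa [map_sub, sub_eq_zero] at this
    rcases (Component.proj_le_proj_iff σ f b a).mp hyx with h2 | h2
    · have := (Component.proj_eq_zero_iff σ f (b - a)).mpr (by simpa using h2)
      rw [map_sub, sub_eq_zero] at this
      exact this.symm
    · rw [le_antisymm h1 h2]
  le_total x y := by
    obtain ⟨a, rfl⟩ := Component.proj_surjective σ f x
    obtain ⟨b, rfl⟩ := Component.proj_surjective σ f y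
    rcases le_total a b with h | h
    · exact Or.inl ⟨a, b, rfl, rfl, h⟩
    · exact Or.inr ⟨b, a, rfl, rfl, h⟩
  toDecidableLE := Classical.decRel _

instance (σ : FiniteArchimedeanClass G →o Set.Iic (0 : G)) (f : Set.Iic (0 : G)) :
    IsOrderedAddMonoid (Component σ f) where
  add_le_add_left x y hxy z := by
    obtain ⟨a, b, rfl, rfl, hab⟩ := hxy
    obtain ⟨c, rfl⟩ := Component.proj_surjective σ f z
    exact ⟨a + c, b + c, map_add _ _ _, map_add _ _ _, add_le_add_left hab c⟩

end Shift

end HDer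

namespace HDer

/-! ### From couples of H-type to right-shifts -/

section Couple

variable {G : Type*} [AddCommGroup G] [LinearOrder G] {ψ : {g : G // g ≠ 0} → G}

/-! From a derivation to a shift: a couple of H-type makes `ψ` an increasing function of the natural
valuation, but `ψ` need not be nonpositive or a right-shift. It is repaired without changing its
fibres (`exists_rightShift`): each value `ψ x` is replaced by its asymptotic integral, the `z` with
`z + ψ z = ψ x`, or, if some value has none, that value is the maximum of `ψ` and is subtracted from
it. The logarithmic derivative of monomials is additive in the exponent, and its coefficient at `ψ
x` vanishes exactly on the lower group of the fibre, so this coefficient embeds the component into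
`k`.

From a shift to a derivation: the embeddings of the components are extended to homomorphisms `w f :
G → k`, and the derivation sends `t^g` to `∑ w f g t^(g+f)`. Arbitrary extensions would not give
summable families. A Hahn embedding of `G` makes it possible to let `w f g` depend only on the
coordinates of `g` in the fibre of `σ` over `f`; the well-ordered supports of the Hahn series and
the right-shift property then give summability (`IsRightShift.exists_lt_or_eq`). Since `g ↦ g + σ
(v_G g)` is strictly increasing, dominant terms go to dominant terms (`derivation_dominant`), which
yields constants `k` and logarithmic derivatives of valuation `σ (v_G g)`.

In the ordered case the hull of the constants is the usual valuation ring, so the H-field axioms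
reduce to a sign condition (`isHField_iff`), and this matches order preservation of the embeddings
up to a global sign. -/

theorem IsAsymptoticCouple.map_neg (h : IsAsymptoticCouple ψ) (g : {g : G // g ≠ 0})
    (hg : -(g : G) ≠ 0) : ψ ⟨-g, hg⟩ = ψ g := by
  simpa using h.ac2 g (-1) (by simpa using g.2)

theorem IsAsymptoticCouple.map_abs (h : IsAsymptoticCouple ψ) (g : {g : G // g ≠ 0})
    (hg : |(g : G)| ≠ 0) : ψ ⟨|(g : G)|, hg⟩ = ψ g := by
  rcases abs_choice (g : G) with e | e
  · congr 1; exact Subtype.ext e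
  · rw [← h.map_neg g (neg_ne_zero.mpr g.2)]; congr 1; exact Subtype.ext e

variable [IsOrderedAddMonoid G]

namespace IsHTypeAsymptoticCouple

/-- An asymptotic couple of H-type factors monotonically through the natural valuation. -/
theorem map_le_of_mk_le (h : IsHTypeAsymptoticCouple ψ) {x y : {g : G // g ≠ 0}}
    (hxy : ArchimedeanClass.mk (x : G) ≤ ArchimedeanClass.mk (y : G)) : ψ x ≤ ψ y := by
  obtain ⟨n, hn⟩ := ArchimedeanClass.mk_le_mk.mp hxy
  have hx : |(x : G)| ≠ 0 := by simpa using x.2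
  have hy : |(y : G)| ≠ 0 := by simpa using y.2
  have hypos : 0 < |(y : G)| := abs_pos.mpr y.2
  have hnx : n • |(x : G)| ≠ 0 := (hypos.trans_le hn).ne'
  -- Signs and nonzero multiples do not affect `ψ`; both elements are moved below zero, where the
  -- H-type axiom applies.
  have e1 : ψ ⟨-(n • |(x : G)|), neg_ne_zero.mpr hnx⟩ = ψ x := by
    rw [h.map_neg ⟨n • |(x : G)|, hnx⟩, ← h.map_abs x hx]
    have := h.ac2 ⟨|(x : G)|, hx⟩ n (by simpa using hnx)
    simpa using this
  have e2 : ψ ⟨-|(y : G)|, neg_ne_zero.mpr hy⟩ = ψ y := by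
    rw [h.map_neg ⟨|(y : G)|, hy⟩, h.map_abs]
  rw [← e1, ← e2]
  exact h.ach _ _ (neg_le_neg hn) (neg_neg_of_pos hypos)

theorem mk_lt_of_map_lt (h : IsHTypeAsymptoticCouple ψ) {x y : {g : G // g ≠ 0}}
    (hxy : ψ x < ψ y) : ArchimedeanClass.mk (x : G) < ArchimedeanClass.mk (y : G) := by
  by_contra! hc
  exact (h.map_le_of_mk_le hc).not_gt hxy

/-- Otherwise `d = ψ y - ψ x` would satisfy `ψ d ≤ ψ x`, and `ac3` would give `ψ y < ψ d + d ≤ ψ y`.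
-/
theorem mk_lt_mk_map_sub (h : IsHTypeAsymptoticCouple ψ) {x y : {g : G // g ≠ 0}}
    (hxy : ψ x < ψ y) : ArchimedeanClass.mk (x : G) < ArchimedeanClass.mk (ψ y - ψ x) := by
  by_contra! hc
  have hd : 0 < ψ y - ψ x := sub_pos.mpr hxy
  have h1 := h.map_le_of_mk_le (x := ⟨ψ y - ψ x, hd.ne'⟩) hc
  have h2 := h.ac3 y ⟨ψ y - ψ x, hd.ne'⟩
  rw [abs_of_pos hd] at h2
  have h3 := h2.trans_le (add_le_add_left h1 _)
  simp at h3

/-- The integral is `c - ψ y`: it differs from `y` by the negligible `ψ x - ψ y`, so it has the same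
archimedean class as `y` and the same value of `ψ`. -/
theorem exists_integral_of_map_sub_lt (h : IsHTypeAsymptoticCouple ψ) {c : G}
    {x y : {g : G // g ≠ 0}} (hy : (y : G) = c - ψ x) (hlt : ψ y < ψ x) :
    ∃ z : {g : G // g ≠ 0}, (z : G) + ψ z = c := by
  have hv := h.mk_lt_mk_map_sub hlt
  have e : ArchimedeanClass.mk ((y : G) + (ψ x - ψ y)) = ArchimedeanClass.mk (y : G) :=
    ArchimedeanClass.mk_add_eq_mk_left hv
  have e2 : (y : G) + (ψ x - ψ y) = c - ψ y := by rw [hy]; abel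
  rw [e2] at e
  have hne : c - ψ y ≠ 0 := by
    intro h0
    rw [h0, ArchimedeanClass.mk_zero, eq_comm, ArchimedeanClass.mk_eq_top_iff] at e
    exact y.2 e
  refine ⟨⟨c - ψ y, hne⟩, ?_⟩
  have : ψ ⟨c - ψ y, hne⟩ = ψ y :=
    le_antisymm (h.map_le_of_mk_le e.le) (h.map_le_of_mk_le e.ge)
  rw [this]; simp

/-- Everything below some value of `ψ` has an asymptotic integral. -/
theorem exists_integral_of_lt (h : IsHTypeAsymptoticCouple ψ) {c : G}
    {x : {g : G // g ≠ 0}} (hc : c < ψ x) :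
    ∃ z : {g : G // g ≠ 0}, (z : G) + ψ z = c := by
  let y : {g : G // g ≠ 0} := ⟨c - ψ x, (sub_neg.mpr hc).ne⟩
  rcases lt_trichotomy (ψ y) (ψ x) with hlt | heq | hgt
  · exact h.exists_integral_of_map_sub_lt rfl hlt
  · exact ⟨y, by rw [heq]; simp [y]⟩
  -- A second approximation `z < y < 0` gives `ψ z ≤ ψ y`, so the iteration stops here.
  · have hcy : c < ψ y := hc.trans hgt
    let z : {g : G // g ≠ 0} := ⟨c - ψ y, (sub_neg.mpr hcy).ne⟩
    have hzy : ψ z ≤ ψ y := h.ach z y (sub_le_sub_left hgt.le c) (sub_neg.mpr hc)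
    rcases hzy.lt_or_eq with hlt | heq
    · exact h.exists_integral_of_map_sub_lt rfl hlt
    · exact ⟨z, by rw [heq]; simp [z]⟩

/-- A couple of H-type can be replaced by a right-shift with the same fibres. -/
theorem exists_rightShift (h : IsHTypeAsymptoticCouple ψ) :
    ∃ σ : FiniteArchimedeanClass G →o Set.Iic (0 : G), IsRightShift σ ∧
      ∀ x y : {g : G // g ≠ 0},
        σ (.mk x x.2) < σ (.mk y y.2) ↔ ψ x < ψ y := by
  obtain ⟨φ, hle, hmono, hshift⟩ : ∃ φ : {g : G // g ≠ 0} → G, (∀ x, φ x ≤ 0) ∧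
      (∀ x y, φ x < φ y ↔ ψ x < ψ y) ∧
      ∀ x : {g : G // g ≠ 0}, ArchimedeanClass.mk (x : G) < ArchimedeanClass.mk (φ x) := by
    by_cases hint : ∀ x, ∃ z : {g : G // g ≠ 0}, (z : G) + ψ z = ψ x
    -- All values of `ψ` have integrals: the new shift is `x ↦ z x`, negative by `ac3`.
    · choose z hz using hint
      have hneg : ∀ x, (z x : G) < 0 := by
        intro x
        by_contra! hc
        have h1 := h.ac3 x (z x)
        rw [abs_of_nonneg hc, add_comm, hz] at h1
        exact h1.false
      have hlt : ∀ x y, ψ x < ψ y → (z x : G) < z y := by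
        intro x y hxy
        by_contra! hc
        have h1 := add_le_add hc (h.ach _ _ hc (hneg x))
        rw [hz, hz] at h1
        exact h1.not_gt hxy
      refine ⟨fun x => z x, fun x => (hneg x).le, fun x y => ⟨fun hxy => ?_, hlt x y⟩, ?_⟩
      · have h1 := add_lt_add_of_lt_of_le hxy (h.ach _ _ hxy.le (hneg y))
        rwa [hz, hz] at h1
      · intro x
        apply h.mk_lt_of_map_lt
        rw [← hz x]
        simpa using hneg x
    -- A value without an integral is an upper bound of `ψ`, so subtracting it makes `ψ`
    -- nonpositive.
    · push Not at hint
      obtain ⟨x₀, hx₀⟩ := hint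
      have hmax : ∀ x, ψ x ≤ ψ x₀ := by
        intro x
        by_contra! hc
        obtain ⟨z, hz⟩ := h.exists_integral_of_lt hc
        exact hx₀ z hz
      refine ⟨fun x => ψ x - ψ x₀, fun x => sub_nonpos.mpr (hmax x), fun x y => by simp, ?_⟩
      intro x
      rcases (hmax x).lt_or_eq with hlt | heq
      · rw [ArchimedeanClass.mk_sub_comm]
        exact h.mk_lt_mk_map_sub hlt
      · beta_reduce
        rw [heq, sub_self, ArchimedeanClass.mk_zero, lt_top_iff_ne_top, ne_eq,
          ArchimedeanClass.mk_eq_top_iff]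
        exact x.2
  have hm : ∀ x y : {g : G // g ≠ 0},
      FiniteArchimedeanClass.mk x.1 x.2 ≤ FiniteArchimedeanClass.mk y.1 y.2 → φ x ≤ φ y := by
    intro x y hxy
    by_contra! hc
    exact (h.map_le_of_mk_le hxy).not_gt ((hmono y x).mp hc)
  let σ : FiniteArchimedeanClass G →o Set.Iic (0 : G) :=
    FiniteArchimedeanClass.liftOrderHom (fun x => ⟨φ x, hle x⟩) fun x y hxy => hm x y hxy
  have hσ : ∀ x : {g : G // g ≠ 0}, σ (.mk x x.2) = ⟨φ x, hle x⟩ := fun x =>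
    FiniteArchimedeanClass.liftOrderHom_mk _ _ x.2
  refine ⟨σ, ?_, fun x y => ?_⟩
  · intro γ
    induction γ using FiniteArchimedeanClass.ind with
    | mk a ha =>
      rw [hσ ⟨a, ha⟩]
      exact hshift ⟨a, ha⟩
  · rw [hσ, hσ]
    exact hmono x y

end IsHTypeAsymptoticCouple

end Couple

/-! ### Logarithmic derivatives of monomials and embeddings of the components -/

section LogDeriv

variable {G : Type*} [AddCommGroup G] [LinearOrder G] [IsOrderedAddMonoid G]
  {k : Type*} [Field k]

/-- The logarithmic derivative of the monomial with exponent `g`. -/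
noncomputable def monomialLogDeriv (D : Derivation ℤ k⟦G⟧ k⟦G⟧) : G →+ k⟦G⟧ where
  toFun g := D (HahnSeries.single g 1) * HahnSeries.single (-g) 1
  map_zero' := by simp
  map_add' g h := by
    have e : (HahnSeries.single (g + h) 1 : k⟦G⟧) =
        HahnSeries.single g 1 * HahnSeries.single h 1 := by
      simp [HahnSeries.single_mul_single]
    have e1 : (HahnSeries.single (-(g + h)) 1 : k⟦G⟧) =
        HahnSeries.single (-g) 1 * HahnSeries.single (-h) 1 := by
      simp [HahnSeries.single_mul_single, add_comm]
    have e2 : ∀ g : G, (HahnSeries.single g 1 : k⟦G⟧) * HahnSeries.single (-g) 1 = 1 := by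
      intro g
      simp [HahnSeries.single_mul_single]
    rw [e, e1, Derivation.leibniz, smul_eq_mul, smul_eq_mul]
    linear_combination (D (HahnSeries.single h 1) * HahnSeries.single (-h) 1) * e2 g +
      (D (HahnSeries.single g 1) * HahnSeries.single (-g) 1) * e2 h

theorem IsInducedByLogDeriv.orderTop_monomialLogDeriv {D : Derivation ℤ k⟦G⟧ k⟦G⟧}
    {ψ : {g : G // g ≠ 0} → G} (h : IsInducedByLogDeriv (HahnSeries.addVal G k) D ψ)
    (g : {g : G // g ≠ 0}) : (monomialLogDeriv D g).orderTop = ψ g := by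
  have h1 := h (HahnSeries.single (g : G) 1) g (by
    rw [HahnSeries.addVal_apply, HahnSeries.orderTop_single one_ne_zero])
  have e : (HahnSeries.single (g : G) 1 : k⟦G⟧)⁻¹ = HahnSeries.single (-(g : G)) 1 := by
    apply inv_eq_of_mul_eq_one_right
    simp [HahnSeries.single_mul_single]
  rw [div_eq_mul_inv, e, HahnSeries.addVal_apply] at h1
  exact h1

variable {D : Derivation ℤ k⟦G⟧ k⟦G⟧} {ψ : {g : G // g ≠ 0} → G}
  {σ : FiniteArchimedeanClass G →o Set.Iic (0 : G)}

theorem IsInducedByLogDeriv.coeff_eq_zero_iff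
    (h : IsInducedByLogDeriv (HahnSeries.addVal G k) D ψ)
    (hσ : ∀ x y : {g : G // g ≠ 0}, σ (.mk x x.2) < σ (.mk y y.2) ↔ ψ x < ψ y)
    (x : {g : G // g ≠ 0}) {g : G} (hg : g ∈ groupPlus σ (σ (.mk x x.2))) :
    (monomialLogDeriv D g).coeff (ψ x) = 0 ↔ g ∈ groupMinus σ (σ (.mk x x.2)) := by
  by_cases hg0 : g = 0
  · subst hg0
    simp [zero_mem]
  have h1 := h.orderTop_monomialLogDeriv ⟨g, hg0⟩
  have hle : ψ x ≤ ψ ⟨g, hg0⟩ := by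
    by_contra! hc
    exact (hg hg0).not_gt ((hσ ⟨g, hg0⟩ x).mpr hc)
  have hmem : g ∈ groupMinus σ (σ (.mk x x.2)) ↔ ψ x < ψ ⟨g, hg0⟩ := by
    rw [← hσ]
    exact ⟨fun h => h hg0, fun h _ => h⟩
  rw [hmem]
  constructor
  · intro h0
    refine hle.lt_of_ne fun e => ?_
    rw [← e] at h1
    exact HahnSeries.coeff_orderTop_ne h1 h0
  · intro hlt
    refine HahnSeries.coeff_eq_zero_of_lt_orderTop ?_
    rw [h1]
    exact WithTop.coe_lt_coe.mpr hlt

theorem IsInducedByLogDeriv.exists_component_hom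
    (h : IsInducedByLogDeriv (HahnSeries.addVal G k) D ψ)
    (hσ : ∀ x y : {g : G // g ≠ 0}, σ (.mk x x.2) < σ (.mk y y.2) ↔ ψ x < ψ y)
    (x : {g : G // g ≠ 0}) :
    ∃ u : Component σ (σ (.mk x x.2)) →+ k, Function.Injective u ∧
      ∀ g : groupPlus σ (σ (.mk x x.2)),
        u (Component.proj σ _ g) = (monomialLogDeriv D g).coeff (ψ x) := by
  let φ : groupPlus σ (σ (.mk x x.2)) →+ k :=
    ((HahnSeries.coeff.addMonoidHom (ψ x)).comp (monomialLogDeriv D)).comp (AddSubgroup.subtype _)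
  have hφ : ∀ g, φ g = 0 ↔ (g : G) ∈ groupMinus σ (σ (.mk x x.2)) :=
    fun g => h.coeff_eq_zero_iff hσ x g.2
  let u : Component σ (σ (.mk x x.2)) →+ k := QuotientAddGroup.lift _ φ (by
    intro g hg
    exact (hφ g).mpr (AddSubgroup.mem_addSubgroupOf.mp hg))
  have hu : ∀ g, u (Component.proj σ _ g) = φ g := fun g => rfl
  refine ⟨u, (injective_iff_map_eq_zero u).mpr fun y hy => ?_, hu⟩
  obtain ⟨g, rfl⟩ := Component.proj_surjective σ _ y
  rw [hu, hφ] at hy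
  exact (Component.proj_eq_zero_iff σ _ g).mpr hy

/-- The exponent `p` is kept so that nonzero values of `u` are known to be leading coefficients,
which carry the sign in the ordered case. -/
theorem IsHDerivation.exists_rightShift (h : IsHDerivation (HahnSeries.addVal G k) D) :
    ∃ σ : FiniteArchimedeanClass G →o Set.Iic (0 : G), IsRightShift σ ∧
      ∀ f ∈ Set.range σ, ∃ u : Component σ f →+ k, Function.Injective u ∧
        ∃ p : G, ∀ g : groupPlus σ f,
          u (Component.proj σ _ g) = (monomialLogDeriv D g).coeff p ∧
          (u (Component.proj σ _ g) ≠ 0 → (monomialLogDeriv D g).orderTop = p) := by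
  obtain ⟨-, ψ, hψ, hH⟩ := h
  obtain ⟨σ, hs, hσ⟩ := hH.exists_rightShift
  refine ⟨σ, hs, ?_⟩
  rintro _ ⟨γ, rfl⟩
  induction γ using FiniteArchimedeanClass.ind with
  | mk a ha =>
    obtain ⟨u, hu, hu'⟩ := hψ.exists_component_hom hσ ⟨a, ha⟩
    refine ⟨u, hu, ψ ⟨a, ha⟩, fun g => ⟨hu' g, fun hne => ?_⟩⟩
    have hmem := (hψ.coeff_eq_zero_iff hσ ⟨a, ha⟩ g.2).not.mp (by rwa [← hu'])
    have hg0 : (g : G) ≠ 0 := by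
      intro h0
      apply hmem
      rw [h0]
      exact zero_mem _
    have h1 : ψ ⟨g, hg0⟩ ≤ ψ ⟨a, ha⟩ := by
      by_contra! hc
      exact hmem fun _ => (hσ ⟨a, ha⟩ ⟨g, hg0⟩).mpr hc
    have h2 : ψ ⟨a, ha⟩ ≤ ψ ⟨g, hg0⟩ := by
      by_contra! hc
      exact (g.2 hg0).not_gt ((hσ ⟨g, hg0⟩ ⟨a, ha⟩).mpr hc)
    rw [← le_antisymm h1 h2]
    exact hψ.orderTop_monomialLogDeriv ⟨g, hg0⟩

end LogDeriv

/-! ### Summability and dominant terms of the derivation built from weights -/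

section Construction

variable {G : Type*} [AddCommGroup G] [LinearOrder G]
  {k : Type*} [Field k]

/-- The map `∑ a_g t^g ↦ ∑ φ(g) a_g t^g`. -/
def weight (φ : G →+ k) (a : k⟦G⟧) : k⟦G⟧ where
  coeff g := φ g * a.coeff g
  isPWO_support' := a.isPWO_support.mono fun g hg => by
    simp only [Function.mem_support] at hg
    exact right_ne_zero_of_mul hg

@[simp]
theorem weight_coeff (φ : G →+ k) (a : k⟦G⟧) (g : G) :
    (weight φ a).coeff g = φ g * a.coeff g := rfl

theorem weight_add (φ : G →+ k) (a b : k⟦G⟧) :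
    weight φ (a + b) = weight φ a + weight φ b := by
  ext g
  simp [mul_add]

theorem weight_support_subset (φ : G →+ k) (a : k⟦G⟧) : (weight φ a).support ⊆ a.support :=
  fun g hg => by
    simp only [HahnSeries.mem_support, weight_coeff] at hg
    exact right_ne_zero_of_mul hg

variable [IsOrderedAddMonoid G]

theorem weight_mul (φ : G →+ k) (a b : k⟦G⟧) :
    weight φ (a * b) = a * weight φ b + b * weight φ a := by
  ext x
  -- Weighting only shrinks supports, so all three products can be summed over the same
  -- antidiagonal; additivity of `φ` then gives the Leibniz rule termwise.
  rw [mul_comm b, HahnSeries.coeff_add,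
    HahnSeries.coeff_mul_right' b.isPWO_support (weight_support_subset φ b),
    HahnSeries.coeff_mul_left' a.isPWO_support (weight_support_subset φ a),
    weight_coeff, HahnSeries.coeff_mul, Finset.mul_sum, ← Finset.sum_add_distrib]
  refine Finset.sum_congr rfl fun p hp => ?_
  have hx : p.1 + p.2 = x := (Finset.mem_antidiagonal.mp hp).2.2
  rw [← hx, map_add, weight_coeff, weight_coeff]
  ring

variable {σ : FiniteArchimedeanClass G →o Set.Iic (0 : G)} {ι : G →+ ℝ⟦FiniteArchimedeanClass G⟧}

/-- `ι` is compatible with the natural valuation of `G`. -/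
def IsHahnEmbedding (ι : G →+ ℝ⟦FiniteArchimedeanClass G⟧) : Prop :=
  ∀ a, ArchimedeanClass.mk a = FiniteArchimedeanClass.withTopOrderIso G (ι a).orderTop

variable (G) in
theorem exists_isHahnEmbedding : ∃ ι : G →+ ℝ⟦FiniteArchimedeanClass G⟧, IsHahnEmbedding ι := by
  obtain ⟨f, -, hf⟩ := hahnEmbedding_isOrderedAddMonoid G
  exact ⟨{ toFun := fun a => ofLex (f a)
           map_zero' := by simp
           map_add' := fun a b => by simp }, hf⟩

theorem IsHahnEmbedding.orderTop_eq (h : IsHahnEmbedding ι) {g : G} (hg : g ≠ 0) :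
    (ι g).orderTop = (FiniteArchimedeanClass.mk g hg : FiniteArchimedeanClass G) := by
  apply (FiniteArchimedeanClass.withTopOrderIso G).injective
  rw [← h g, FiniteArchimedeanClass.withTopOrderIso_apply_coe]
  rfl

theorem IsHahnEmbedding.coeff_mk_ne_zero (h : IsHahnEmbedding ι) {g : G} (hg : g ≠ 0) :
    (ι g).coeff (FiniteArchimedeanClass.mk g hg) ≠ 0 :=
  HahnSeries.coeff_orderTop_ne (h.orderTop_eq hg)

theorem IsHahnEmbedding.mk_le (h : IsHahnEmbedding ι) {g : G} (hg : g ≠ 0)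
    {γ : FiniteArchimedeanClass G} (hγ : (ι g).coeff γ ≠ 0) :
    FiniteArchimedeanClass.mk g hg ≤ γ := by
  have h1 := HahnSeries.orderTop_le_of_coeff_ne_zero hγ
  rw [h.orderTop_eq hg] at h1
  exact WithTop.coe_le_coe.mp h1

theorem IsHahnEmbedding.coeff_eq_zero (h : IsHahnEmbedding ι) {g : G}
    {γ : FiniteArchimedeanClass G} (hγ : (γ : ArchimedeanClass G) < ArchimedeanClass.mk g) :
    (ι g).coeff γ = 0 := by
  by_cases hg : g = 0
  · simp [hg]
  by_contra hc
  exact (h.mk_le hg hc).not_gt hγ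

theorem ne_zero_of_coeff_ne_zero {g : G} {γ : FiniteArchimedeanClass G}
    (hγ : (ι g).coeff γ ≠ 0) : g ≠ 0 := by
  rintro rfl
  simp at hγ

theorem IsRightShift.lt_mk_sub (hσ : IsRightShift σ) {γ δ : FiniteArchimedeanClass G}
    (h : γ ≤ δ) : (γ : ArchimedeanClass G) < ArchimedeanClass.mk ((σ δ : G) - σ γ) :=
  (lt_min ((show (γ : ArchimedeanClass G) ≤ δ from h).trans_lt (hσ δ)) (hσ γ)).trans_le
    (ArchimedeanClass.min_le_mk_sub _ _)

/-- `g ↦ g + σ (v_G g)` is strictly increasing. -/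
theorem IsRightShift.add_lt_add (hσ : IsRightShift σ) {g h : G} (hg : g ≠ 0) (hh : h ≠ 0)
    (hlt : g < h) : g + (σ (.mk g hg) : G) < h + (σ (.mk h hh) : G) := by
  rcases le_or_gt (FiniteArchimedeanClass.mk g hg) (.mk h hh) with hle | hgt
  · exact add_lt_add_of_lt_of_le hlt (σ.monotone hle)
  -- Here `h` dominates `g`, so `h - g` has the class of `h` and outweighs the difference of the
  -- shifts.
  · have h1 := hσ.lt_mk_sub hgt.le
    have h2 : ArchimedeanClass.mk (h - g) = ArchimedeanClass.mk h :=
      ArchimedeanClass.mk_sub_eq_mk_left hgt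
    have h3 := ArchimedeanClass.lt_of_mk_lt_mk_of_nonneg (h2.trans_lt h1) (sub_pos.mpr hlt).le
    rw [sub_lt_sub_iff] at h3
    rwa [add_comm g, add_comm h] at *

theorem IsRightShift.abs_lt (hσ : IsRightShift σ) {g : G} (hg : g ≠ 0) :
    0 < (σ (.mk g hg) : G) + |g| := by
  have h1 := hσ (.mk g hg)
  have h2 : ArchimedeanClass.mk |g| < ArchimedeanClass.mk (-(σ (.mk g hg) : G)) := by
    rwa [ArchimedeanClass.mk_abs, ArchimedeanClass.mk_neg]
  have h3 := ArchimedeanClass.lt_of_mk_lt_mk_of_nonneg h2 (abs_nonneg g)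
  exact neg_lt_iff_pos_add'.mp h3

/-- In a sequence of pairs `(g, γ)`, with `g` in a fixed well-ordered set and `γ` in the support of
`ι g`, either `g + σ γ` increases somewhere or a pair `(g, σ γ)` is repeated. -/
theorem IsRightShift.exists_lt_or_eq (hσ : IsRightShift σ) (hι : IsHahnEmbedding ι) {S : Set G}
    (hS : S.IsPWO) (g : ℕ → G) (γ : ℕ → FiniteArchimedeanClass G) (hg : ∀ n, g n ∈ S)
    (hγ : ∀ n, (ι (g n)).coeff (γ n) ≠ 0) :
    ∃ m n, m < n ∧ (g m + (σ (γ m) : G) < g n + (σ (γ n) : G) ∨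
      g m = g n ∧ σ (γ m) = σ (γ n)) := by
  by_contra! hc
  -- Along a subsequence with `g` weakly increasing, a counterexample has `σ γ` strictly decreasing,
  -- hence also `γ`.
  obtain ⟨e, he⟩ := hS.exists_monotone_subseq hg
  have hlt : ∀ m n, m < n → (σ (γ (e n)) : G) < σ (γ (e m)) := by
    intro m n hmn
    obtain ⟨h1, h2⟩ := hc (e m) (e n) (e.strictMono hmn)
    have hle : g (e m) ≤ g (e n) := he hmn.le
    rcases hle.eq_or_lt with heq | hlt
    · have h3 := h2 heq
      rw [heq] at h1
      exact lt_of_le_of_ne (by simpa using h1) fun h => h3 (Subtype.ext h.symm)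
    · by_contra! h4
      exact (add_lt_add_of_lt_of_le hlt h4).not_ge h1
  have hγlt : ∀ m n, m < n → γ (e n) < γ (e m) := by
    intro m n hmn
    by_contra! h
    exact (σ.monotone h).not_gt (hlt m n hmn)
  -- The increase of `g` is bounded by a difference of shifts, whose class is above `γ (e (n + 1))`.
  -- So the two Hahn series agree at that coordinate, and the descending `γ` all lie in the
  -- well-ordered support of one series.
  have hmem : ∀ n, (ι (g (e 0))).coeff (γ (e (n + 1))) ≠ 0 := by
    intro n
    have h1 := hσ.lt_mk_sub (hγlt 0 (n + 1) n.succ_pos).le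
    have h2 : 0 ≤ g (e (n + 1)) - g (e 0) := sub_nonneg.mpr (he (Nat.zero_le _))
    have h3 : g (e (n + 1)) - g (e 0) ≤ (σ (γ (e 0)) : G) - σ (γ (e (n + 1))) := by
      have := (hc (e 0) (e (n + 1)) (e.strictMono n.succ_pos)).1
      rw [sub_le_sub_iff, add_comm (σ (γ (e 0)) : G)]
      exact this
    have h4 := h1.trans_le (ArchimedeanClass.mk_antitoneOn h2 (h2.trans h3) h3)
    have h5 := hι.coeff_eq_zero h4
    rw [map_sub, HahnSeries.coeff_sub, sub_eq_zero] at h5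
    rw [← h5]
    exact hγ _
  have hwf := (ι (g (e 0))).isPWO_support
  obtain ⟨m, n, hmn, hle⟩ := hwf (fun n => ⟨γ (e (n + 1)), hmem n⟩)
  exact (show γ (e (m + 1)) ≤ γ (e (n + 1)) from hle).not_gt (hγlt (m + 1) (n + 1) (by omega))

/-- The weights used to differentiate: `w f g` is the coefficient of `t^f` in the logarithmic
derivative of `t^g`. -/
structure IsWeightFamily (σ : FiniteArchimedeanClass G →o Set.Iic (0 : G))
    (ι : G →+ ℝ⟦FiniteArchimedeanClass G⟧) (w : G → G →+ k) : Prop where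
  shift : IsRightShift σ
  emb : IsHahnEmbedding ι
  supp : ∀ f g, w f g ≠ 0 → ∃ γ, (ι g).coeff γ ≠ 0 ∧ (σ γ : G) = f

variable {w : G → G →+ k}

theorem IsWeightFamily.supp_of_coeff (hw : IsWeightFamily σ ι w) {a : k⟦G⟧} {f x : G}
    (h : (HahnSeries.single f 1 * weight (w f) a).coeff x ≠ 0) :
    a.coeff (x - f) ≠ 0 ∧ ∃ γ, (ι (x - f)).coeff γ ≠ 0 ∧ (σ γ : G) = f := by
  rw [HahnSeries.coeff_single_mul, one_mul, weight_coeff] at h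
  exact ⟨right_ne_zero_of_mul h, hw.supp _ _ (left_ne_zero_of_mul h)⟩

/-- The summable family `f ↦ t^f ∑ w_f(g) a_g t^g`. -/
noncomputable def IsWeightFamily.family (hw : IsWeightFamily σ ι w) (a : k⟦G⟧) :
    HahnSeries.SummableFamily G k G where
  toFun f := HahnSeries.single f 1 * weight (w f) a
  isPWO_iUnion_support' := by
    intro x
    have hx' : ∀ n, ∃ f, a.coeff ((x n : G) - f) ≠ 0 ∧
        ∃ γ, (ι ((x n : G) - f)).coeff γ ≠ 0 ∧ (σ γ : G) = f := by
      intro n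
      obtain ⟨f, hf⟩ := Set.mem_iUnion.mp (x n).2
      exact ⟨f, hw.supp_of_coeff hf⟩
    choose f hf γ hγ hfγ using hx'
    obtain ⟨m, n, hmn, h⟩ := hw.shift.exists_lt_or_eq hw.emb a.isPWO_support
      (fun n => (x n : G) - f n) γ hf hγ
    refine ⟨m, n, hmn, show (x m : G) ≤ x n from ?_⟩
    rcases h with h | ⟨h1, h2⟩
    · rw [hfγ, hfγ] at h
      simpa using h.le
    · rw [← Subtype.coe_inj, hfγ, hfγ] at h2
      simp only [h2, sub_left_inj] at h1
      exact h1.le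
  finite_co_support' x := by
    by_contra hinf
    let e := Set.Infinite.natEmbedding _ hinf
    have hx' : ∀ n, a.coeff (x - e n) ≠ 0 ∧
        ∃ γ, (ι (x - e n)).coeff γ ≠ 0 ∧ (σ γ : G) = e n := fun n => hw.supp_of_coeff (e n).2
    choose hf γ hγ hfγ using hx'
    -- With `x` fixed, `g + σ γ = x` is constant, and a repeated pair contradicts injectivity of
    -- `e`.
    obtain ⟨m, n, hmn, h⟩ := hw.shift.exists_lt_or_eq hw.emb a.isPWO_support (fun n => x - e n) γ
      hf hγ
    rcases h with h | ⟨h1, -⟩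
    · simp [hfγ] at h
    · exact hmn.ne (e.injective (Subtype.ext (by simpa using h1)))

theorem IsWeightFamily.family_apply (hw : IsWeightFamily σ ι w) (a : k⟦G⟧) (f : G) :
    hw.family a f = HahnSeries.single f 1 * weight (w f) a := rfl

/-- The derivation `∑ a_g t^g ↦ ∑ a_g w_f(g) t^(g+f)`. -/
noncomputable def IsWeightFamily.derivation (hw : IsWeightFamily σ ι w) :
    Derivation ℤ k⟦G⟧ k⟦G⟧ :=
  Derivation.mk'
    (AddMonoidHom.toIntLinearMap
      { toFun := fun a => (hw.family a).hsum
        map_zero' := by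
          rw [← HahnSeries.SummableFamily.hsum_zero (α := G)]
          congr 1
          ext f x
          simp [hw.family_apply, HahnSeries.coeff_single_mul]
        map_add' := fun a b => by
          rw [← HahnSeries.SummableFamily.hsum_add]
          congr 1
          ext1 f
          simp [hw.family_apply, weight_add, mul_add] })
    (fun a b => by
      change (hw.family (a * b)).hsum = a * (hw.family b).hsum + b * (hw.family a).hsum
      rw [← HahnSeries.SummableFamily.hsum_smul, ← HahnSeries.SummableFamily.hsum_smul,
        ← HahnSeries.SummableFamily.hsum_add]
      congr 1
      ext1 f
      rw [HahnSeries.SummableFamily.add_apply, HahnSeries.SummableFamily.smul_apply,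
        HahnSeries.SummableFamily.smul_apply, HahnSeries.of_symm_smul_of_eq_mul,
        HahnSeries.of_symm_smul_of_eq_mul, hw.family_apply, hw.family_apply, hw.family_apply,
        weight_mul]
      ring)

theorem IsWeightFamily.derivation_coeff (hw : IsWeightFamily σ ι w) (a : k⟦G⟧) (x : G) :
    (hw.derivation a).coeff x = ∑ᶠ f, w f (x - f) * a.coeff (x - f) := by
  change (hw.family a).hsum.coeff x = _
  rw [HahnSeries.SummableFamily.coeff_hsum]
  refine finsum_congr fun f => ?_
  rw [hw.family_apply, HahnSeries.coeff_single_mul, one_mul, weight_coeff]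

/-- The dominant term of a derivative. -/
theorem IsWeightFamily.derivation_dominant (hw : IsWeightFamily σ ι w) {a : k⟦G⟧} {g : G}
    (hg : g ≠ 0) (hmin : ∀ h, h ≠ 0 → a.coeff h ≠ 0 → g ≤ h) :
    (hw.derivation a).coeff (g + (σ (.mk g hg) : G)) =
      w (σ (.mk g hg) : G) g * a.coeff g ∧
    ∀ x, (hw.derivation a).coeff x ≠ 0 → g + (σ (.mk g hg) : G) ≤ x := by
  -- A contribution from `h = x - f` has `f = σ γ` with `γ` at or above the class of `h`, so `x ≥ h
  -- + σ (v_G h)`, and strict monotonicity of this map allows equality only at `h = g`.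
  have key : ∀ f x, w f (x - f) * a.coeff (x - f) ≠ 0 →
      g + (σ (.mk g hg) : G) ≤ x ∧ (g + (σ (.mk g hg) : G) = x → x - f = g) := by
    intro f x h
    obtain ⟨γ, hγ, rfl⟩ := hw.supp _ _ (left_ne_zero_of_mul h)
    have h0 := ne_zero_of_coeff_ne_zero hγ
    have h1 := hmin _ h0 (right_ne_zero_of_mul h)
    have h2 : x - (σ γ : G) + (σ (.mk _ h0) : G) ≤ x := by
      have : (σ (.mk _ h0) : G) ≤ σ γ := σ.monotone (hw.emb.mk_le h0 hγ)
      calc x - (σ γ : G) + (σ (.mk _ h0) : G) ≤ x - (σ γ : G) + σ γ := by gcongr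
        _ = x := by simp
    rcases h1.eq_or_lt with heq | hlt
    · refine ⟨?_, fun _ => heq.symm⟩
      have : (FiniteArchimedeanClass.mk g hg) = .mk _ h0 := by congr 1
      rw [this]
      exact (add_le_add_left heq.le _).trans h2
    · have h3 := (hw.shift.add_lt_add hg h0 hlt).trans_le h2
      exact ⟨h3.le, fun h => absurd h h3.ne⟩
  constructor
  · rw [hw.derivation_coeff, finsum_eq_single _ (σ (.mk g hg) : G)]
    · simp
    · intro f hf
      by_contra hc
      have := (key f _ hc).2 rfl
      apply hf
      rw [sub_eq_iff_eq_add] at this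
      exact (add_left_cancel this).symm
  · intro x hx
    rw [hw.derivation_coeff] at hx
    by_contra hc
    refine hx ((finsum_congr fun f => ?_).trans finsum_zero)
    by_contra hf
    exact hc (key f x hf).1

theorem IsWeightFamily.derivation_C (hw : IsWeightFamily σ ι w) (c : k) :
    hw.derivation (HahnSeries.C c) = 0 := by
  ext x
  rw [hw.derivation_coeff, HahnSeries.coeff_zero]
  refine (finsum_congr fun f => ?_).trans finsum_zero
  by_cases h : x - f = 0
  · simp [h]
  · simp [HahnSeries.C_apply, HahnSeries.coeff_single_of_ne h]

end Construction

/-! ### Extending the embeddings of the components to weights on `G` -/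

section Weights

variable {G : Type*} [AddCommGroup G] [LinearOrder G] [IsOrderedAddMonoid G]
  {k : Type*} [Field k] {σ : FiniteArchimedeanClass G →o Set.Iic (0 : G)}
  {ι : G →+ ℝ⟦FiniteArchimedeanClass G⟧}

theorem archimedeanClass_mk_zsmul {n : ℤ} (hn : n ≠ 0) (g : G) :
    ArchimedeanClass.mk (n • g) = ArchimedeanClass.mk g := by
  refine ArchimedeanClass.mk_eq_mk.mpr ⟨⟨1, ?_⟩, ⟨n.natAbs, ?_⟩⟩
  · rw [one_nsmul, abs_zsmul]
    simpa using zsmul_le_zsmul_left (abs_nonneg g) (Int.one_le_abs hn)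
  · rw [abs_zsmul, ← natCast_zsmul, Int.natCast_natAbs]

theorem mem_groupPlus_self (σ : FiniteArchimedeanClass G →o Set.Iic (0 : G)) {g : G}
    (hg : g ≠ 0) : g ∈ groupPlus σ (σ (.mk g hg)) :=
  fun _ => le_rfl

theorem notMem_groupMinus_self (σ : FiniteArchimedeanClass G →o Set.Iic (0 : G)) {g : G}
    (hg : g ≠ 0) : g ∉ groupMinus σ (σ (.mk g hg)) :=
  fun h => (h hg).false

theorem Component.proj_self_ne_zero (σ : FiniteArchimedeanClass G →o Set.Iic (0 : G)) {g : G}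
    (hg : g ≠ 0) : Component.proj σ _ ⟨g, mem_groupPlus_self σ hg⟩ ≠ 0 :=
  (Component.proj_eq_zero_iff σ _ _).not.mpr (notMem_groupMinus_self σ hg)

/-- A component of `G` is torsion-free, so it only embeds into fields of characteristic zero. -/
theorem charZero_of_component {g : G} (hg : g ≠ 0) (u : Component σ (σ (.mk g hg)) →+ k)
    (hu : Function.Injective u) : CharZero k := by
  refine charZero_of_inj_zero fun n hn => ?_
  by_contra hn0
  have h1 : u (Component.proj σ _ (n • ⟨g, mem_groupPlus_self σ hg⟩)) = 0 := by
    rw [map_nsmul, map_nsmul, nsmul_eq_mul, hn, zero_mul]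
  rw [map_eq_zero_iff u hu, Component.proj_eq_zero_iff] at h1
  have hng : n • g ≠ 0 := smul_ne_zero hn0 hg
  have h2 := h1 hng
  have e : FiniteArchimedeanClass.mk (n • g) hng = .mk g hg :=
    Subtype.ext (by
      rw [FiniteArchimedeanClass.val_mk, FiniteArchimedeanClass.val_mk, ← natCast_zsmul]
      exact archimedeanClass_mk_zsmul (by exact_mod_cast hn0) g)
  change σ (.mk g hg) < σ (FiniteArchimedeanClass.mk (n • g) hng) at h2
  rw [e] at h2
  exact h2.false

/-- A homomorphism on a component extends to `G`, in a way that only depends on the part of the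
Hahn series of `g` supported on the fibre of `σ`. -/
theorem IsHahnEmbedding.exists_extension [CharZero k] (hι : IsHahnEmbedding ι)
    (f : Set.Iic (0 : G)) (u : Component σ f →+ k) :
    ∃ v : G →+ k, (∀ g, v g ≠ 0 → ∃ γ, (ι g).coeff γ ≠ 0 ∧ σ γ = f) ∧
      ∀ g : groupPlus σ f, v g = u (Component.proj σ f g) := by
  -- On `groupPlus` the kernel of the fibre coordinates is `groupMinus`, so `r` embeds the component
  -- into a product of copies of `ℝ`.
  let r : G →+ ({γ // σ γ = f} → ℝ) :=
    { toFun := fun g γ => (ι g).coeff γ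
      map_zero' := by ext; simp
      map_add' := fun a b => by ext; simp }
  have hr : ∀ g ∈ groupPlus σ f, r g = 0 ↔ g ∈ groupMinus σ f := by
    intro g hg
    constructor
    · intro h hg0
      refine (hg hg0).lt_of_ne fun e => ?_
      exact hι.coeff_mk_ne_zero hg0 (congrFun h ⟨_, e.symm⟩)
    · intro h
      ext γ
      by_contra hc
      change (ι g).coeff γ ≠ 0 at hc
      have hg0 := ne_zero_of_coeff_ne_zero hc
      have h1 := (h hg0).trans_le (σ.monotone (hι.mk_le hg0 hc))
      rw [γ.2] at h1
      exact h1.false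
  let j : Component σ f →+ ({γ // σ γ = f} → ℝ) :=
    QuotientAddGroup.lift _ (r.comp (AddSubgroup.subtype (groupPlus σ f))) fun g hg =>
      (hr g g.2).mpr (AddSubgroup.mem_addSubgroupOf.mp hg)
  have hj : ∀ g : groupPlus σ f, j (Component.proj σ f g) = r g := fun g => rfl
  have hinj : Function.Injective j := by
    refine (injective_iff_map_eq_zero j).mpr fun y hy => ?_
    obtain ⟨g, rfl⟩ := Component.proj_surjective σ _ y
    rw [hj, hr g g.2] at hy
    exact (Component.proj_eq_zero_iff σ _ g).mpr hy
  -- In characteristic zero `k` is divisible, hence an injective abelian group.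
  obtain ⟨W, hW⟩ := (Module.Baer.of_divisible k).extension_property_addMonoidHom j hinj u
  refine ⟨W.comp r, fun g hg => ?_, fun g => ?_⟩
  · by_contra! hc
    apply hg
    have : r g = 0 := by
      ext γ
      by_contra h
      exact hc γ h γ.2
    simp [this]
  · rw [← hW, AddMonoidHom.comp_apply, AddMonoidHom.comp_apply, hj]

theorem IsHahnEmbedding.exists_isWeightFamily [CharZero k] (hι : IsHahnEmbedding ι)
    (hσ : IsRightShift σ) (u : ∀ f ∈ Set.range σ, Component σ f →+ k) :
    ∃ w : G → G →+ k, IsWeightFamily σ ι w ∧ ∀ (g : G) (hg : g ≠ 0),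
      w (σ (.mk g hg) : G) g =
        u _ (Set.mem_range_self _) (Component.proj σ _ ⟨g, mem_groupPlus_self σ hg⟩) := by
  classical
  choose v hv hvu using fun (f : Set.Iic (0 : G)) (hf : f ∈ Set.range σ) =>
    hι.exists_extension f (u f hf)
  refine ⟨fun f => if h : ∃ h0 : f ∈ Set.Iic (0 : G), ⟨f, h0⟩ ∈ Set.range σ
    then v ⟨f, h.1⟩ h.2 else 0, ⟨hσ, hι, fun f g hfg => ?_⟩, fun g hg => ?_⟩
  · split_ifs at hfg with h
    · obtain ⟨γ, h1, h2⟩ := hv _ _ g hfg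
      exact ⟨γ, h1, congrArg Subtype.val h2⟩
    · simp at hfg
  · have h : ∃ h0 : (σ (.mk g hg) : G) ∈ Set.Iic (0 : G),
        (⟨(σ (.mk g hg) : G), h0⟩ : Set.Iic (0 : G)) ∈ Set.range σ :=
      ⟨(σ (.mk g hg)).2, Set.mem_range_self _⟩
    beta_reduce
    rw [dif_pos h]
    exact hvu _ (Set.mem_range_self _) ⟨g, mem_groupPlus_self σ hg⟩

end Weights

/-! ### Derivations governed by a shift are H-derivations -/

section ShiftDerivation

variable {G : Type*} [AddCommGroup G] [LinearOrder G] [IsOrderedAddMonoid G]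
  {k : Type*} [Field k] {σ : FiniteArchimedeanClass G →o Set.Iic (0 : G)}

/-- `D` vanishes on `k`, and if `a_g t^g` is the dominant nonconstant term of `a`, then
`τ(g) a_g t^(g + σ (v_G g))` is the dominant term of `D a`. -/
structure IsShiftDerivation (σ : FiniteArchimedeanClass G →o Set.Iic (0 : G)) (τ : G → k)
    (D : Derivation ℤ k⟦G⟧ k⟦G⟧) : Prop where
  shift : IsRightShift σ
  ne_zero : ∀ g, g ≠ 0 → τ g ≠ 0
  map_C : ∀ c, D (HahnSeries.C c) = 0
  coeff_eq : ∀ (a : k⟦G⟧) (g : G) (hg : g ≠ 0), (∀ h, h ≠ 0 → a.coeff h ≠ 0 → g ≤ h) →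
    (D a).coeff (g + (σ (.mk g hg) : G)) = τ g * a.coeff g
  le_of_coeff_ne_zero : ∀ (a : k⟦G⟧) (g : G) (hg : g ≠ 0),
    (∀ h, h ≠ 0 → a.coeff h ≠ 0 → g ≤ h) →
      ∀ x, (D a).coeff x ≠ 0 → g + (σ (.mk g hg) : G) ≤ x

theorem exists_isShiftDerivation (hσ : IsRightShift σ)
    (u : ∀ f ∈ Set.range σ, Component σ f →+ k) (hu : ∀ f hf, Function.Injective (u f hf)) :
    ∃ (τ : G → k) (D : Derivation ℤ k⟦G⟧ k⟦G⟧), IsShiftDerivation σ τ D ∧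
      ∀ (g : G) (hg : g ≠ 0), τ g =
        u _ (Set.mem_range_self _) (Component.proj σ _ ⟨g, mem_groupPlus_self σ hg⟩) := by
  classical
  -- If `G` is trivial there are no components to force characteristic zero, but the zero derivation
  -- works.
  rcases subsingleton_or_nontrivial G with hG | hG
  · have h0 : ∀ g : G, g = 0 := fun g => Subsingleton.elim g 0
    exact ⟨0, 0, ⟨hσ, fun g hg => absurd (h0 g) hg, fun c => rfl, fun a g hg => absurd (h0 g) hg,
      fun a g hg => absurd (h0 g) hg⟩, fun g hg => absurd (h0 g) hg⟩
  obtain ⟨g₀, hg₀⟩ := exists_ne (0 : G)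
  have := charZero_of_component hg₀ (u _ (Set.mem_range_self _)) (hu _ _)
  obtain ⟨ι, hι⟩ := exists_isHahnEmbedding G
  obtain ⟨w, hw, hwu⟩ := hι.exists_isWeightFamily hσ u
  let τ : G → k := fun g => if hg : g ≠ 0 then w (σ (.mk g hg) : G) g else 0
  have hτ : ∀ (g : G) (hg : g ≠ 0), τ g = w (σ (.mk g hg) : G) g := fun g hg => dif_pos hg
  refine ⟨τ, hw.derivation, ⟨hσ, fun g hg => ?_, hw.derivation_C, fun a g hg hmin => ?_,
    fun a g hg hmin => (hw.derivation_dominant hg hmin).2⟩, fun g hg => by rw [hτ g hg, hwu]⟩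
  · rw [hτ g hg, hwu, ne_eq, map_eq_zero_iff _ (hu _ _)]
    exact Component.proj_self_ne_zero σ hg
  · rw [hτ g hg]
    exact (hw.derivation_dominant hg hmin).1

namespace IsShiftDerivation

variable {τ : G → k} {D : Derivation ℤ k⟦G⟧ k⟦G⟧}

theorem orderTop_eq (h : IsShiftDerivation σ τ D) {a : k⟦G⟧} {g : G} (hg : g ≠ 0)
    (hag : a.coeff g ≠ 0) (hmin : ∀ h, h ≠ 0 → a.coeff h ≠ 0 → g ≤ h) :
    (D a).orderTop = ((g + (σ (.mk g hg) : G) : G) : WithTop G) := by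
  apply HahnSeries.orderTop_eq_of_le
  · rw [HahnSeries.mem_support, h.coeff_eq a g hg hmin]
    exact mul_ne_zero (h.ne_zero g hg) hag
  · intro x hx
    exact h.le_of_coeff_ne_zero a g hg hmin x hx

end IsShiftDerivation

theorem min_of_orderTop_eq {G k : Type*} [AddCommGroup G] [LinearOrder G] [Zero k]
    {a : k⟦G⟧} {g : G} (ha : a.orderTop = g) :
    a.coeff g ≠ 0 ∧ ∀ h, h ≠ 0 → a.coeff h ≠ 0 → g ≤ h :=
  ⟨HahnSeries.coeff_orderTop_ne ha, fun h _ hh => by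
    have := HahnSeries.orderTop_le_of_coeff_ne_zero hh
    rw [ha] at this
    exact WithTop.coe_le_coe.mp this⟩

theorem eq_C_or_exists_dominant (a : k⟦G⟧) : a = HahnSeries.C (a.coeff 0) ∨
    ∃ g, g ≠ 0 ∧ a.coeff g ≠ 0 ∧ ∀ h, h ≠ 0 → a.coeff h ≠ 0 → g ≤ h := by
  by_cases hne : (a.support \ {0}).Nonempty
  · right
    have hwf : (a.support \ {0}).IsWF := a.isWF_support.mono Set.sdiff_subset
    have hm := hwf.min_mem hne
    exact ⟨hwf.min hne, hm.2, hm.1, fun h h0 hh => hwf.min_le hne ⟨hh, h0⟩⟩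
  · left
    ext g
    by_cases hg : g = 0
    · simp [hg]
    · rw [HahnSeries.C_apply, HahnSeries.coeff_single_of_ne hg]
      by_contra hc
      exact hne ⟨g, hc, hg⟩

namespace IsShiftDerivation

variable {τ : G → k} {D : Derivation ℤ k⟦G⟧ k⟦G⟧}

theorem isInducedByLogDeriv (h : IsShiftDerivation σ τ D) :
    IsInducedByLogDeriv (HahnSeries.addVal G k) D fun g => (σ (.mk g g.2) : G) := by
  intro a g ha
  have ha0 : a ≠ 0 := by
    rintro rfl
    simp at ha
  rw [HahnSeries.addVal_apply] at ha
  obtain ⟨h1, h2⟩ := min_of_orderTop_eq ha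
  have h3 := h.orderTop_eq g.2 h1 h2
  have h4 : HahnSeries.addVal G k (D a / a) + HahnSeries.addVal G k a =
      HahnSeries.addVal G k (D a) := by
    rw [← AddValuation.map_mul, div_mul_cancel₀ _ ha0]
  rw [HahnSeries.addVal_apply (x := a), HahnSeries.addVal_apply (x := D a), h3, ha, add_comm,
    WithTop.coe_add] at h4
  exact WithTop.add_left_cancel WithTop.coe_ne_top h4

theorem eq_C_of_map_eq_zero (h : IsShiftDerivation σ τ D) {a : k⟦G⟧} (ha : D a = 0) :
    a = HahnSeries.C (a.coeff 0) := by
  rcases eq_C_or_exists_dominant a with hC | ⟨g, hg, h1, h2⟩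
  · exact hC
  · have := h.orderTop_eq hg h1 h2
    rw [ha, HahnSeries.orderTop_zero] at this
    exact absurd this.symm WithTop.coe_ne_top

/-- Zero separates the two valuations in `dv2`: logarithmic derivatives have valuation in the range
of `σ`, and `g + σ (v_G g) > 0` for `g > 0`. The decomposition in `dv1` takes the constant
coefficient, the constants being exactly `k`. -/
theorem isDifferentialValued (h : IsShiftDerivation σ τ D) :
    IsDifferentialValued (HahnSeries.addVal G k) D where
  dv2 a b ha hb hb0 := by
    have hbo := HahnSeries.addVal_apply_of_ne hb0
    have hbpos : b.order ≠ 0 := by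
      rintro e
      rw [hbo, e] at hb
      simp at hb
    rw [h.isInducedByLogDeriv b ⟨b.order, hbpos⟩ hbo]
    refine lt_of_le_of_lt (b := ((0 : G) : WithTop G)) (WithTop.coe_le_coe.mpr (σ _).2) ?_
    change _ < HahnSeries.addVal G k (D a)
    rw [HahnSeries.addVal_apply]
    rcases eq_C_or_exists_dominant a with hC | ⟨g, hg, h1, h2⟩
    · rw [hC, h.map_C]
      simp
    · rw [h.orderTop_eq hg h1 h2, WithTop.coe_lt_coe]
      have hg0 : 0 ≤ g := WithTop.coe_le_coe.mp
        (ha.trans (HahnSeries.addVal_le_of_coeff_ne_zero h1))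
      have := h.shift.abs_lt hg
      rwa [abs_of_nonneg hg0, add_comm] at this
  dv1 a := by
    constructor
    · intro ha
      refine ⟨a - HahnSeries.C (a.coeff 0), HahnSeries.C (a.coeff 0), ?_, h.map_C _, by simp⟩
      by_contra! hc
      have hne : a - HahnSeries.C (a.coeff 0) ≠ 0 := by
        intro h0
        rw [h0] at hc
        simp at hc
      rw [HahnSeries.addVal_apply_of_ne hne] at hc
      have hle : (a - HahnSeries.C (a.coeff 0)).order ≤ 0 := WithTop.coe_le_coe.mp hc
      have h1 := (HahnSeries.coeff_order_eq_zero.not).mpr hne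
      rcases hle.eq_or_lt with he | hlt
      · rw [he] at h1
        simp at h1
      · have h2 : (HahnSeries.C (a.coeff 0) : k⟦G⟧).coeff (a - HahnSeries.C (a.coeff 0)).order = 0 :=
          HahnSeries.coeff_single_of_ne hlt.ne
        rw [HahnSeries.coeff_sub, h2, sub_zero] at h1
        have := ha.trans (HahnSeries.addVal_le_of_coeff_ne_zero h1)
        exact (WithTop.coe_le_coe.mp this).not_gt hlt
    · rintro ⟨m, c, hm, hc, rfl⟩
      refine AddValuation.map_le_add _ hm.le ?_
      rw [h.eq_C_of_map_eq_zero hc, HahnSeries.addVal_apply]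
      by_cases h0 : c.coeff 0 = 0
      · simp [h0]
      · rw [HahnSeries.C_apply, HahnSeries.orderTop_single h0]
        rfl

theorem isHDerivation (h : IsShiftDerivation σ τ D) :
    IsHDerivation (HahnSeries.addVal G k) D := by
  refine ⟨h.isDifferentialValued, _, h.isInducedByLogDeriv, ⟨?_, ?_, ?_⟩, ?_⟩
  · intro x y hxy
    rcases min_le_iff.mp (FiniteArchimedeanClass.min_le_mk_add x.2 y.2 hxy) with h1 | h1
    · exact (min_le_left _ _).trans (σ.monotone h1)
    · exact (min_le_right _ _).trans (σ.monotone h1)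
  · intro x n hn
    have hn0 : n ≠ 0 := by
      rintro rfl
      simp at hn
    have e : FiniteArchimedeanClass.mk (n • (x : G)) hn = .mk x x.2 :=
      Subtype.ext (archimedeanClass_mk_zsmul hn0 _)
    simp only [e]
  · intro x y
    exact lt_of_le_of_lt (σ (.mk x x.2)).2 (h.shift.abs_lt y.2)
  · intro x y hxy hy
    exact σ.monotone (ArchimedeanClass.mk_monotoneOn (hxy.trans hy.le) hy.le hxy)

end IsShiftDerivation

end ShiftDerivation

/-! ### The order on the series field and the H-field axioms -/

section Lex

variable {G : Type*} [AddCommGroup G] [LinearOrder G] [IsOrderedAddMonoid G]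
  {k : Type*} [Field k]

/-- A derivation of `k((G))` seen on the copy of this field which carries the order. -/
noncomputable def toLexDerivation (D : Derivation ℤ k⟦G⟧ k⟦G⟧) : Derivation ℤ (Lex k⟦G⟧) (Lex k⟦G⟧) :=
  Derivation.mk'
    (AddMonoidHom.toIntLinearMap
      { toFun := fun a => toLex (D (ofLex a))
        map_zero' := congrArg toLex (map_zero D)
        map_add' := fun a b => congrArg toLex (map_add D (ofLex a) (ofLex b)) })
    (fun a b => congrArg toLex (D.leibniz (ofLex a) (ofLex b)))

/-- The inverse of `toLexDerivation`. -/
noncomputable def ofLexDerivation (D : Derivation ℤ (Lex k⟦G⟧) (Lex k⟦G⟧)) : Derivation ℤ k⟦G⟧ k⟦G⟧ :=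
  Derivation.mk'
    (AddMonoidHom.toIntLinearMap
      { toFun := fun a => ofLex (D (toLex a))
        map_zero' := congrArg ofLex (map_zero D)
        map_add' := fun a b => congrArg ofLex (map_add D (toLex a) (toLex b)) })
    (fun a b => congrArg ofLex (D.leibniz (toLex a) (toLex b)))

theorem lexVal_apply (a : Lex k⟦G⟧) : lexVal G k a = (ofLex a).orderTop := by
  rw [← HahnSeries.addVal_apply]
  rfl

theorem isHDerivation_toLexDerivation (D : Derivation ℤ k⟦G⟧ k⟦G⟧) :
    IsHDerivation (lexVal G k) (toLexDerivation D) ↔ IsHDerivation (HahnSeries.addVal G k) D := by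
  constructor
  · rintro ⟨⟨⟨h1⟩, h2⟩, ψ, h3, h4⟩
    exact ⟨⟨⟨h1⟩, h2⟩, ψ, h3, h4⟩
  · rintro ⟨⟨⟨h1⟩, h2⟩, ψ, h3, h4⟩
    exact ⟨⟨⟨h1⟩, h2⟩, ψ, h3, h4⟩

theorem toLexDerivation_ofLexDerivation (D : Derivation ℤ (Lex k⟦G⟧) (Lex k⟦G⟧)) :
    toLexDerivation (ofLexDerivation D) = D := by
  ext1 a
  rfl

variable [LinearOrder k] [IsStrictOrderedRing k]

theorem lexVal_le_of_abs_le {a b : Lex k⟦G⟧} (h : |a| ≤ b) : lexVal G k b ≤ lexVal G k a := by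
  rw [lexVal_apply, lexVal_apply, ← HahnSeries.orderTop_abs a]
  by_contra! hc
  have hb : 0 ≤ b := (abs_nonneg a).trans h
  have hne : ofLex |a| ≠ 0 := HahnSeries.orderTop_ne_top.mp hc.ne_top
  -- If `|a|` had smaller valuation than `b`, it would dominate and make `b - |a|` negative.
  have e : (ofLex (b - |a|)).leadingCoeff = -(ofLex |a|).leadingCoeff := by
    rw [ofLex_sub, sub_eq_add_neg, HahnSeries.leadingCoeff_add_eq_right
      (by rwa [HahnSeries.orderTop_neg]), HahnSeries.leadingCoeff_neg]
  have h1 : 0 ≤ (ofLex (b - |a|)).leadingCoeff :=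
    HahnSeries.leadingCoeff_nonneg_iff.mpr (sub_nonneg.mpr h)
  have h2 : 0 < (ofLex |a|).leadingCoeff :=
    HahnSeries.leadingCoeff_pos_iff.mpr (lt_of_le_of_ne (abs_nonneg a) (Ne.symm hne))
  rw [e] at h1
  linarith

theorem lt_of_lexVal_lt {a b : Lex k⟦G⟧} (ha : 0 < a) (h : lexVal G k a < lexVal G k b) :
    b < a := by
  by_contra! hc
  have := lexVal_le_of_abs_le (by rwa [abs_of_pos ha] : |a| ≤ b)
  exact this.not_gt h

variable {D : Derivation ℤ (Lex k⟦G⟧) (Lex k⟦G⟧)}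

theorem IsHDerivation.mem_constantHull_iff (hD : IsHDerivation (lexVal G k) D) (a : Lex k⟦G⟧) :
    a ∈ constantHull D ↔ 0 ≤ lexVal G k a := by
  obtain ⟨hdv, -⟩ := hD
  constructor
  · rintro ⟨c, hc, hac⟩
    exact ((hdv.dv1 c).mpr ⟨0, c, by simp, hc, by simp⟩).trans (lexVal_le_of_abs_le hac)
  · intro ha
    obtain ⟨m, c, hm, hc, rfl⟩ := (hdv.dv1 a).mp ha
    have h1 : |m| < 1 := by
      apply lt_of_lexVal_lt (one_pos : (0 : Lex k⟦G⟧) < 1)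
      rw [AddValuation.map_one, lexVal_apply, HahnSeries.orderTop_abs, ← lexVal_apply]
      exact hm
    refine ⟨1 + |c|, add_mem (one_mem _) ?_, (abs_add_le m c).trans (by gcongr)⟩
    rcases abs_choice c with e | e
    · rwa [e]
    · rw [e]
      exact neg_mem hc

/-- The two valuations have the same valuation ring, and comparing `a` with `b` amounts to testing
whether `b / a` lies in it. This transfers all axioms between them. -/
theorem IsHDerivation.hullValuation_le_iff (hD : IsHDerivation (lexVal G k) D)
    (a b : Lex k⟦G⟧) :
    hullValuation D a ≤ hullValuation D b ↔ lexVal G k a ≤ lexVal G k b := by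
  have h0 : hullValuation D a ≤ hullValuation D b ↔
      (constantHull D).valuation b ≤ (constantHull D).valuation a := Iff.rfl
  rw [h0]
  by_cases ha : a = 0
  · subst ha
    rw [map_zero, le_zero_iff, map_eq_zero, AddValuation.map_zero, top_le_iff,
      AddValuation.top_iff]
  have h1 : (constantHull D).valuation b ≤ (constantHull D).valuation a ↔
      (constantHull D).valuation (b / a) ≤ 1 := by
    rw [map_div₀, div_le_one₀ (by
      rw [zero_lt_iff]
      exact (map_ne_zero _).mpr ha)]
  rw [h1, ValuationSubring.valuation_le_one_iff, hD.mem_constantHull_iff]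
  have h2 : lexVal G k b = lexVal G k (b / a) + lexVal G k a := by
    rw [← AddValuation.map_mul, div_mul_cancel₀ _ ha]
  rw [h2]
  have h3 : lexVal G k a ≠ ⊤ := (AddValuation.top_iff _).not.mpr ha
  lift lexVal G k a to G using h3 with x
  cases lexVal G k (b / a) with
  | top => simp
  | coe y =>
    norm_cast
    simp

theorem IsHDerivation.hullValuation_lt_iff (hD : IsHDerivation (lexVal G k) D)
    (a b : Lex k⟦G⟧) :
    hullValuation D a < hullValuation D b ↔ lexVal G k a < lexVal G k b := by
  rw [← not_le, ← not_le, hD.hullValuation_le_iff]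

theorem IsHDerivation.hullValuation_nonneg_iff (hD : IsHDerivation (lexVal G k) D)
    (a : Lex k⟦G⟧) : 0 ≤ hullValuation D a ↔ 0 ≤ lexVal G k a := by
  simpa using hD.hullValuation_le_iff 1 a

theorem IsHDerivation.hullValuation_pos_iff (hD : IsHDerivation (lexVal G k) D)
    (a : Lex k⟦G⟧) : 0 < hullValuation D a ↔ 0 < lexVal G k a := by
  simpa using hD.hullValuation_lt_iff 1 a

/-- For an H-derivation on `k((G))`, being an H-field is only a condition on signs. -/
theorem IsHDerivation.isHField_iff (hD : IsHDerivation (lexVal G k) D) :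
    IsHField D ↔ ∀ a, 0 < a → lexVal G k a < 0 → 0 < D a := by
  have hinf : ∀ a : Lex k⟦G⟧, (∀ b, 0 ≤ hullValuation D b → b < a) ↔
      0 < a ∧ lexVal G k a < 0 := by
    intro a
    constructor
    · intro h
      refine ⟨h 0 (by simp), ?_⟩
      by_contra! hc
      exact (h a ((hD.hullValuation_nonneg_iff a).mpr hc)).false
    · rintro ⟨h1, h2⟩ b hb
      exact lt_of_lexVal_lt h1 (h2.trans_le ((hD.hullValuation_nonneg_iff b).mp hb))
  constructor
  · intro h a h1 h2
    exact h.h1.pos a ((hinf a).mpr ⟨h1, h2⟩)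
  · intro h
    refine ⟨⟨⟨fun a b ha hb hb0 => ?_⟩, ⟨fun a ha b hb c hc => ?_⟩, fun a ha => ?_⟩, fun a => ?_⟩
    · rw [hD.hullValuation_nonneg_iff] at ha
      rw [hD.hullValuation_pos_iff] at hb
      rw [hD.hullValuation_lt_iff]
      exact hD.1.dv2 a b ha hb hb0
    · simp only [Set.mem_ofPred_eq, hD.hullValuation_nonneg_iff] at ha hb ⊢
      rcases le_total 0 c with h0 | h0
      · exact hb.trans (lexVal_le_of_abs_le (by rw [abs_of_nonneg h0]; exact hc.2))
      · rw [← AddValuation.map_neg] at ha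
        exact ha.trans (lexVal_le_of_abs_le (by rw [abs_of_nonpos h0]; exact neg_le_neg hc.1))
    · obtain ⟨h1, h2⟩ := (hinf a).mp ha
      exact h a h1 h2
    · rw [hD.hullValuation_nonneg_iff]
      simp only [hD.hullValuation_pos_iff]
      exact hD.1.dv1 a

end Lex

/-! ### The two equivalences -/

section Main

variable {G : Type*} [AddCommGroup G] [LinearOrder G] [IsOrderedAddMonoid G]
  {k : Type*} [Field k]

theorem leadingCoeff_of_orderTop_eq {Γ R : Type*} [PartialOrder Γ] [Zero R] {a : R⟦Γ⟧} {g : Γ}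
    (h : a.orderTop = g) : a.leadingCoeff = a.coeff g := by
  have hne : a.orderTop ≠ ⊤ := by simp [h]
  rw [← HahnSeries.coeff_untop_eq_leadingCoeff hne]
  simp [h]

theorem exists_isHDerivation_iff :
    (∃ D : Derivation ℤ k⟦G⟧ k⟦G⟧, IsHDerivation (HahnSeries.addVal G k) D) ↔
      ∃ σ : FiniteArchimedeanClass G →o Set.Iic (0 : G), IsRightShift σ ∧
        ∀ f ∈ Set.range σ, ∃ u : Component σ f →+ k, Function.Injective u := by
  constructor
  · rintro ⟨D, hD⟩
    obtain ⟨σ, hσ, hu⟩ := hD.exists_rightShift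
    refine ⟨σ, hσ, fun f hf => ?_⟩
    obtain ⟨u, hu, -⟩ := hu f hf
    exact ⟨u, hu⟩
  · rintro ⟨σ, hσ, hu⟩
    choose u hu using hu
    obtain ⟨τ, D, hD, -⟩ := exists_isShiftDerivation hσ u hu
    exact ⟨D, hD.isHDerivation⟩

variable [LinearOrder k] [IsStrictOrderedRing k]

/-- In an H-field the logarithmic derivative of a small monomial is negative. -/
theorem leadingCoeff_monomialLogDeriv_neg {D : Derivation ℤ k⟦G⟧ k⟦G⟧}
    (hD : ∀ a : Lex k⟦G⟧, 0 < a → lexVal G k a < 0 → 0 < toLexDerivation D a) {g : G}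
    (hg : 0 < g) : (monomialLogDeriv D g).leadingCoeff < 0 := by
  have h1 : 0 < toLexDerivation D (toLex (HahnSeries.single (-g) 1)) := by
    apply hD
    · rw [← HahnSeries.leadingCoeff_pos_iff, ofLex_toLex, HahnSeries.leadingCoeff_of_single]
      exact one_pos
    · rw [lexVal_apply, ofLex_toLex, HahnSeries.orderTop_single one_ne_zero]
      exact WithTop.coe_lt_coe.mpr (neg_neg_of_pos hg)
  have h2 : 0 < (D (HahnSeries.single (-g) 1)).leadingCoeff :=
    HahnSeries.leadingCoeff_pos_iff.mpr h1
  have h3 : (monomialLogDeriv D (-g)).leadingCoeff = (D (HahnSeries.single (-g) 1)).leadingCoeff := by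
    change (D (HahnSeries.single (-g) 1) * HahnSeries.single (- -g) 1).leadingCoeff = _
    rw [HahnSeries.leadingCoeff_mul, HahnSeries.leadingCoeff_of_single, mul_one]
  rw [map_neg, HahnSeries.leadingCoeff_neg] at h3
  linarith

theorem exists_isHField_iff :
    (∃ D : Derivation ℤ (Lex k⟦G⟧) (Lex k⟦G⟧), IsHDerivation (lexVal G k) D ∧ IsHField D) ↔
      ∃ σ : FiniteArchimedeanClass G →o Set.Iic (0 : G), IsRightShift σ ∧
        ∀ f ∈ Set.range σ, ∃ u : Component σ f →+o k, Function.Injective u := by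
  constructor
  · rintro ⟨D, hD, hH⟩
    rw [hD.isHField_iff] at hH
    rw [← toLexDerivation_ofLexDerivation D] at hD hH
    rw [isHDerivation_toLexDerivation] at hD
    obtain ⟨σ, hσ, hu⟩ := hD.exists_rightShift
    refine ⟨σ, hσ, fun f hf => ?_⟩
    obtain ⟨u, hu, p, hp⟩ := hu f hf
    -- A positive value would be the leading coefficient of the logarithmic derivative of `t^g` with
    -- `g > 0`, which is negative. Hence `-u` preserves the order.
    have hsign : ∀ z : Component σ f, 0 ≤ z → u z ≤ 0 := by
      intro z hz
      by_contra! hc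
      obtain ⟨g, rfl⟩ := Component.proj_surjective σ f z
      have h0 : (0 : G) < g := by
        rw [← map_zero (Component.proj σ f), Component.proj_le_proj_iff] at hz
        refine lt_of_le_of_ne ?_ ?_
        · rcases hz with h | h
          · have h' : (g : G) ∈ groupMinus σ f := by simpa using h
            rw [(Component.proj_eq_zero_iff σ f g).mpr h', map_zero] at hc
            exact absurd hc (lt_irrefl _)
          · exact h
        · intro h
          have : g = 0 := Subtype.ext h.symm
          simp [this] at hc
      have h1 := leadingCoeff_monomialLogDeriv_neg hH h0
      rw [leadingCoeff_of_orderTop_eq ((hp g).2 hc.ne'), ← (hp g).1] at h1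
      exact h1.not_gt hc
    refine ⟨{ toAddMonoidHom := -u, monotone' := fun x y hxy => ?_ }, fun x y hxy => ?_⟩
    · have := hsign (y - x) (sub_nonneg.mpr hxy)
      rw [map_sub, sub_nonpos] at this
      exact neg_le_neg this
    · exact hu (neg_injective hxy)
  · rintro ⟨σ, hσ, hu⟩
    choose u hu using hu
    -- Infinite elements have negative exponent, so the embeddings are negated to make `τ g`
    -- positive there.
    obtain ⟨τ, D, hD, hτ⟩ := exists_isShiftDerivation hσ (fun f hf => -(u f hf : Component σ f →+ k))
      fun f hf x y hxy => hu f hf (neg_injective hxy)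
    have hLex := (isHDerivation_toLexDerivation D).mpr hD.isHDerivation
    refine ⟨toLexDerivation D, hLex, hLex.isHField_iff.mpr fun a ha hneg => ?_⟩
    rw [lexVal_apply] at hneg
    obtain ⟨g, hg⟩ := WithTop.ne_top_iff_exists.mp hneg.ne_top
    rw [← hg] at hneg
    have hg0 : g < 0 := WithTop.coe_lt_coe.mp hneg
    obtain ⟨h1, h2⟩ := min_of_orderTop_eq hg.symm
    have h3 := hD.orderTop_eq hg0.ne h1 h2
    have hcoeff : 0 < (ofLex a).coeff g := by
      rw [← leadingCoeff_of_orderTop_eq hg.symm]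
      exact HahnSeries.leadingCoeff_pos_iff.mpr ha
    have hτpos : 0 < τ g := by
      refine lt_of_le_of_ne ?_ (hD.ne_zero g hg0.ne).symm
      rw [hτ g hg0.ne]
      refine neg_nonneg.mpr (map_nonpos (u _ _) ?_)
      rw [← map_zero (Component.proj σ _), Component.proj_le_proj_iff]
      exact Or.inr hg0.le
    rw [← HahnSeries.leadingCoeff_pos_iff]
    change 0 < (D (ofLex a)).leadingCoeff
    rw [leadingCoeff_of_orderTop_eq h3, hD.coeff_eq _ g hg0.ne h2]
    exact mul_pos hτpos hcoeff

end Main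
end HDer

theorem mainTheorem7 (G : Type*) [AddCommGroup G] [LinearOrder G] [IsOrderedAddMonoid G]
    (k : Type*) [Field k] :
    ((∃ D : Derivation ℤ k⟦G⟧ k⟦G⟧, HDer.IsHDerivation (HahnSeries.addVal G k) D) ↔
      ∃ σ : FiniteArchimedeanClass G →o Set.Iic (0 : G), HDer.IsRightShift σ ∧
        ∀ f ∈ Set.range σ, ∃ u : HDer.Component σ f →+ k, Function.Injective u) ∧
    ∀ [LinearOrder k] [IsStrictOrderedRing k],
      ((∃ D : Derivation ℤ (Lex k⟦G⟧) (Lex k⟦G⟧),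
          HDer.IsHDerivation (HDer.lexVal G k) D ∧ HDer.IsHField D) ↔
        ∃ σ : FiniteArchimedeanClass G →o Set.Iic (0 : G), HDer.IsRightShift σ ∧
          ∀ f ∈ Set.range σ, ∃ u : HDer.Component σ f →+o k, Function.Injective u) :=
  ⟨HDer.exists_isHDerivation_iff, HDer.exists_isHField_iff⟩
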